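/- **Setting.** Let $\mathcal M=(X,U,r,\mathbb P,\lambda)$ be a Markov decision process with finite state set $X$, finite non-empty action set $U$, transition probabilities $\mathbb P[x'\mid x,u]$ and discount factor $\lambda\in(0,1)$; it is unknown in the sense that the learner only sees sampled transitions. Let $\Delta$ be a set of propositional symbols and $L:X\to2^\Delta$ a labelling function. Let $\mathcal A_R=(\Omega,\Omega_F,\Omega_0,\delta_\varrho,\delta_r)$ be a physics-informed reward machine (pRM) with finitely many states: $\Omega\subseteq\{\varrho_0,\dots,\varrho_M\}\times\mathbb R^\ell$ is finite ($M,\ell\ge1$), $\Omega_F\subseteq\Omega$ is the set of terminal states, $\Omega_0\subseteq\Omega\setminus\Omega_F$ the set of initial states, $\delta_\varrho:\Omega\times2^\Delta\to\Omega$ the transition function and $\delta_r:\Omega\times2^\Delta\to\mathbb R$ the reward function. The product $\mathcal M\otimes\mathcal A_R$ is the MDP with states $X\times\Omega$, actions $U$ and discount factor $\lambda$ in which, under action $u$, a state $(x,\varrho)$ moves with probability $\mathbb P[x'\mid x,u]$ to $(x',\delta_\varrho(\varrho,L(x')))$ with reward $\delta_r(\varrho,L(x'))$ if $\varrho\notin\Omega_F$,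 and to $(x',\varrho)$ with reward $0$ if $\varrho\in\Omega_F$. A policy is optimal if from every initial state it maximises the expected discounted return $\mathbb E[\sum_{k\ge0}\lambda^k r_k]$ among all Markov (randomised, time-dependent) policies. Let $V^*(s)$ be the supremum of the expected discounted returns from $s$, and let $q^*(s,u)$ be the expectation of $r+\lambda V^*(s')$ over the transition from $s$ under $u$, with reward $r$ and successor $s'$. **Algorithm (Q-learning with counterfactual pRM experiences).** Start with an arbitrary table $\tilde q_0:X\times\Omega\times U\to\mathbb R$ and with a product state $(x_0,\varrho_0)$, $\varrho_0\in\Omega_0$. At training step $t$, in state $(x,\varrho)$ with $\varrho\notin\Omega_F$, select an action $u$ by any (possibly randomised) rule that uses only the past, for instance $\varepsilon$-greedily with respect to $\tilde q_t$, and observe $x'\sim\mathbb P[\cdot\mid x,u]$. The pool $\mathcal E$ consists of the experiences $(x,\hat\varrho,u,\hat r,x',\hat\varrho')$ with $\hat r=\delta_r(\hat\varrho,L(x'))$ and $\hat\varrho'=\delta_\varrho(\hat\varrho,L(x'))$, for $\hat\varrho$ in a set that contains $\varrho$ and is contained in $\Omega\setminus\Omega_F$ (all of $\Omega\setminus\Omega_F$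 when all counterfactual experiences are used; in general the set, and the order in which it is processed, is any choice, possibly random, that does not depend on $x'$ given the past and $u$). For the experiences of $\mathcal E$, one after another, update $$\tilde q(x,\hat\varrho,u)\leftarrow\tilde q(x,\hat\varrho,u)+\kappa\,\bigl(y-\tilde q(x,\hat\varrho,u)\bigr),\qquad y=\begin{cases}\hat r+\lambda\max_{u'\in U}\tilde q(x',\hat\varrho',u')&\text{if }\hat\varrho'\notin\Omega_F,\\ \hat r&\text{if }\hat\varrho'\in\Omega_F.\end{cases}$$ Here the $n$-th update ($n=0,1,\dots$) of the entry $(x,\hat\varrho,u)$ uses the learning rate $\kappa=\kappa_n(x,\hat\varrho,u)\in[0,1]$. The next product state is $(x',\delta_\varrho(\varrho,L(x')))$ if $\delta_\varrho(\varrho,L(x'))\notin\Omega_F$; otherwise a new episode starts in some $(x_0,\varrho_0)$ with $\varrho_0\in\Omega_0$ (chosen in any way from the past). Let $\tilde q_t$ be the table after $t$ training steps. **Theorem.** Suppose that for every $(x,\varrho,u)\in X\times\Omega\times U$ the learning rates satisfy $\sum_n\kappa_n(x,\varrho,u)=\infty$ and $\sum_n\kappa_n(x,\varrho,u)^2<\infty$,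 and that almost surely every triple $(x,\varrho,u)\in X\times(\Omega\setminus\Omega_F)\times U$ is visited infinitely often (the learner is in $(x,\varrho)$ and selects $u$ at infinitely many training steps). Then the algorithm converges to the optimal policy: almost surely, 1. $\tilde q_t(x,\varrho,u)\to q^*((x,\varrho),u)$ as $t\to\infty$ for every $(x,\varrho,u)\in X\times(\Omega\setminus\Omega_F)\times U$, and 2. for all sufficiently large $t$, every map $\pi:X\times\Omega\to U$ that is greedy with respect to $\tilde q_t$, that is, $\pi(x,\varrho)\in\arg\max_{u\in U}\tilde q_t(x,\varrho,u)$ for all $x\in X$ and $\varrho\in\Omega\setminus\Omega_F$, is an optimal (stationary, deterministic) policy of $\mathcal M\otimes\mathcal A_R$. -/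

import Mathlib

open MeasureTheory ProbabilityTheory Filter Topology

noncomputable section

/-- A Markov decision process with states `S`, actions `A`, transition probabilities, a reward
function and a discount factor in `(0, 1]`. -/
structure MDP (S A : Type*) where
  prob : S → A → PMF S
  reward : S → A → S → ℝ
  disc : ℝ
  disc_pos : 0 < disc
  disc_le_one : disc ≤ 1

/-- A (randomised, possibly time-dependent) Markov policy. -/
abbrev Policy (S A : Type*) := ℕ → S → PMF A

/-- The stationary deterministic policy that plays `π s` in state `s`. -/
def Policy.ofMap {S A : Type*} (π : S → A) : Policy S A := fun _ s => PMF.pure (π s)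

namespace MDP

variable {S A : Type*}

/-- The law of the `k`-th state when `M` is started in `s₀` and controlled by `ρ`. -/
def stateLaw (M : MDP S A) (ρ : Policy S A) (s₀ : S) : ℕ → PMF S
  | 0 => PMF.pure s₀
  | k + 1 => (stateLaw M ρ s₀ k).bind fun s => (ρ k s).bind fun a => M.prob s a

/-- The joint law of the `k`-th state, the `k`-th action and the `(k+1)`-st state. -/
def stepLaw (M : MDP S A) (ρ : Policy S A) (s₀ : S) (k : ℕ) : PMF (S × A × S) :=
  (stateLaw M ρ s₀ k).bind fun s => (ρ k s).bind fun a => (M.prob s a).map fun s' => (s, a, s')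

/-- The expectation of the `k`-th reward `r_k`. -/
def expReward (M : MDP S A) (ρ : Policy S A) (s₀ : S) (k : ℕ) : ℝ :=
  ∑' z : S × A × S, (stepLaw M ρ s₀ k z).toReal * M.reward z.1 z.2.1 z.2.2

/-- The expected discounted return `E_ρ [∑ λ^k r_k | s₀]`; for bounded rewards and a discount
factor below one, sum and expectation may be interchanged. -/
def value (M : MDP S A) (ρ : Policy S A) (s₀ : S) : ℝ :=
  ∑' k : ℕ, M.disc ^ k * expReward M ρ s₀ k

/-- A policy is optimal if, from every initial state, it maximises the expected discounted
return among all Markov policies. -/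
def IsOptimal (M : MDP S A) (ρ : Policy S A) : Prop :=
  ∀ (s₀ : S) (ρ' : Policy S A), M.value ρ' s₀ ≤ M.value ρ s₀

/-- The optimal value function. -/
def optValue (M : MDP S A) (s : S) : ℝ := ⨆ ρ : Policy S A, M.value ρ s

/-- The optimal state-action value function. -/
def optQ (M : MDP S A) (s : S) (a : A) : ℝ :=
  ∑' s' : S, (M.prob s a s').toReal * (M.reward s a s' + M.disc * M.optValue s')

end MDP

/-- A physics-informed reward machine over the propositional symbols `Δ`. Its states are hybrid:
a discrete location `ϱ_i`, `i ∈ {0, …, M}`, together with a vector in `ℝ^ℓ`. -/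
structure PRM (Δ : Type*) where
  M : ℕ
  ℓ : ℕ
  one_le_M : 1 ≤ M
  one_le_ℓ : 1 ≤ ℓ
  /-- the set of states -/
  Ω : Set (Fin (M + 1) × EuclideanSpace ℝ (Fin ℓ))
  /-- the terminal states -/
  terminal : Set Ω
  /-- the initial states -/
  initial : Set Ω
  initial_subset : initial ⊆ terminalᶜ
  /-- the state-reward function -/
  δr : Ω → Set Δ → ℝ
  /-- the state-transition function -/
  δϱ : Ω → Set Δ → Ω

section Product

variable {X U Δ : Type*}

open Classical in
/-- The synchronous product of an MDP and a pRM, for the labelling `L`. Terminal pRM states are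
blocking; the run of the pRM is over there, and no further reward is collected. -/
def MDP.product (M : MDP X U) (R : PRM Δ) (L : X → Set Δ) : MDP (X × R.Ω) U where
  prob s u := (M.prob s.1 u).map fun x' =>
    (x', if s.2 ∈ R.terminal then s.2 else R.δϱ s.2 (L x'))
  reward s _ s' := if s.2 ∈ R.terminal then 0 else R.δr s.2 (L s'.1)
  disc := M.disc
  disc_pos := M.disc_pos
  disc_le_one := M.disc_le_one

end Product

section Algorithm

variable {X U Δ : Type*}

/-- The memory of the learner: the table `q̃` and, for every triple, the number of updates
that its entry has received so far. -/
structure Memory (X U : Type*) {Δ : Type*} (R : PRM Δ) where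
  q : X → R.Ω → U → ℝ
  count : X → R.Ω → U → ℕ

open Classical in
/-- The Q-learning target `r̂ + λ max_{u'} q̃(x', ϱ̂', u')` (only `r̂` if `ϱ̂'` is terminal) of the
experience `(x, ϱ̂, u, r̂, x', ϱ̂')`, where `r̂ = δ_r(ϱ̂, L(x'))` and `ϱ̂' = δ_ϱ(ϱ̂, L(x'))`. -/
def qTarget (R : PRM Δ) (L : X → Set Δ) (disc : ℝ) (q : X → R.Ω → U → ℝ) (x' : X) (ϱ : R.Ω) : ℝ :=
  if R.δϱ ϱ (L x') ∈ R.terminal then R.δr ϱ (L x')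
  else R.δr ϱ (L x') + disc * ⨆ u' : U, q x' (R.δϱ ϱ (L x')) u'

open Classical in
/-- One pass through the body of the `for` loop. The `n`-th update (`n = 0, 1, …`) of the entry
`(x, ϱ, u)` uses the learning rate `κ x ϱ u n`. -/
def updateEntry (R : PRM Δ) (L : X → Set Δ) (disc : ℝ) (κ : X → R.Ω → U → ℕ → ℝ)
    (x : X) (u : U) (x' : X) (m : Memory X U R) (ϱ : R.Ω) : Memory X U R where
  q y σ v := if y = x ∧ σ = ϱ ∧ v = u
    then m.q x ϱ u + κ x ϱ u (m.count x ϱ u) * (qTarget R L disc m.q x' ϱ - m.q x ϱ u)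
    else m.q y σ v
  count y σ v := if y = x ∧ σ = ϱ ∧ v = u then m.count x ϱ u + 1 else m.count y σ v

/-- The memory after `t` training steps. At step `t` the environment transition
`(x t, u t, x' t)` is observed and the `for` loop runs, one after another, through the experiences
generated from this transition at the pRM states in the list `E t`. -/
def learn (R : PRM Δ) (L : X → Set Δ) (disc : ℝ) (κ : X → R.Ω → U → ℕ → ℝ)
    (q₀ : X → R.Ω → U → ℝ) (x : ℕ → X) (u : ℕ → U) (x' : ℕ → X) (E : ℕ → List R.Ω) :
    ℕ → Memory X U R
  | 0 => ⟨q₀, fun _ _ _ => 0⟩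
  | t + 1 => (E t).foldl (updateEntry R L disc κ (x t) (u t) (x' t))
      (learn R L disc κ q₀ x u x' E t)

/-- The interaction of the learner with the environment, on a filtered probability space.
`ℱ t` is the information available when the action of training step `t` has been selected;
`(x t, ϱ t)` is the product state, `u t` the selected action (by any rule, randomised or not, that
uses only `ℱ t`), `x' t` the observed successor state, and `E t` lists the pRM states whose
experiences enter the pool of that step, in the order in which they are processed. -/
structure IsTrainingRun {W : Type*} [mW : MeasurableSpace W] (μ : Measure W) (ℱ : Filtration ℕ mW)
    (M : MDP X U) (R : PRM Δ) (L : X → Set Δ)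
    (x : ℕ → W → X) (ϱ : ℕ → W → R.Ω) (u : ℕ → W → U) (x' : ℕ → W → X)
    (E : ℕ → W → List R.Ω) : Prop where
  measurable_x : ∀ t, Measurable[ℱ t, ⊤] (x t)
  measurable_ϱ : ∀ t, Measurable[ℱ t, ⊤] (ϱ t)
  measurable_u : ∀ t, Measurable[ℱ t, ⊤] (u t)
  measurable_E : ∀ t, Measurable[ℱ t, ⊤] (E t)
  measurable_x' : ∀ t, Measurable[ℱ (t + 1), ⊤] (x' t)
  /-- given the past, the successor state is sampled from `ℙ[· | x, u]` -/
  transition : ∀ t (y : X),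
    μ[Set.indicator {w | x' t w = y} (fun _ => (1 : ℝ)) | ℱ t]
      =ᵐ[μ] fun w => (M.prob (x t w) (u t w) y).toReal
  /-- the first episode starts in an initial pRM state -/
  start : ∀ w, ϱ 0 w ∈ R.initial
  /-- the episode goes on as long as no terminal pRM state is reached -/
  continue_step : ∀ t w, R.δϱ (ϱ t w) (L (x' t w)) ∉ R.terminal →
    x (t + 1) w = x' t w ∧ ϱ (t + 1) w = R.δϱ (ϱ t w) (L (x' t w))
  /-- after a terminal pRM state a new episode starts in an initial pRM state -/
  restart_step : ∀ t w, R.δϱ (ϱ t w) (L (x' t w)) ∈ R.terminal → ϱ (t + 1) w ∈ R.initial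
  /-- the pool contains the actual experience … -/
  actual_mem : ∀ t w, ϱ t w ∈ E t w
  /-- … and otherwise counterfactual experiences at non-terminal pRM states (all of them, none, or
  a sample of them), … -/
  nonterminal_of_mem : ∀ t w, ∀ σ ∈ E t w, σ ∉ R.terminal
  /-- … each of them once. -/
  nodup : ∀ t w, (E t w).Nodup

end Algorithm

end

/-!
Why the learner converges. Fix a triple `(x, σ, u)` with `σ` non-terminal. One pass through the
pool moves the entry of this triple towards a target whose expectation, given the past, is the
Bellman operator of the product MDP applied to the current table, a `λ`-contraction for the supremum
norm with fixed point `q*` (`MDP.optQ_product_eq_mean_qTarget`, `abs_qTarget_sub_le`). Counterfactual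
experiences satisfy this as well as the actual one, because the pool is fixed before the
successor state `x'` is drawn and the law of `x'` does not depend on the machine state.

The table is bounded by a constant (`abs_learn_le`), because rewards are bounded, `λ < 1` and all
updates are convex combinations. Hence the target differs from its conditional expectation by two
errors that are harmless after multiplication by the learning rate.

* The sampling noise is a martingale difference sequence, and the squares of the learning rates that
  an entry receives have a deterministic bound on their sum, since these rates are the terms of
  `κ` interspersed with zeros (`sum_learnRate`). So its partial sums are bounded in `L²` and
  converge almost surely (`ae_exists_tendsto_sum_of_sq_sum_le`).
* The experiences of a pool are processed one after another, so the target is computed from a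
  table that has already been changed in this step, in a way that depends on `x'`. This change is of
  the order of the learning rates, so its effect is of second order in the rates, and summable
  (`exists_foldl_updateEntry_eq`).

The rest is deterministic. Along almost every sample path the error `q̃ - q*` solves an asynchronous
recursion with a contracting drift, steps of divergent sum and noise of convergent sum; adding the
tail sums of the noise removes the noise up to a vanishing term, and the contraction pushes the limit
superior of the supremum norm to zero (`tendsto_zero_of_contracting_recursion`).

For the policies, the optimal values satisfy the Bellman equation and any policy that is greedy
for `q*` is optimal (`MDP.isOptimal_ofMap_of_greedy`). There are finitely many strict inequalities
between values of `q*`, and for large `t` the table reproduces all of them, so a maximiser for the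
table is a maximiser for `q*`. At terminal states all values are zero and any action will do.
-/

noncomputable section

/-! ### Expectations under laws on finite types -/

/-- The expectation of `f` under `p`. It is only used on finite types, where the sum has no
convergence issue. -/
def PMF.mean {α : Type*} (p : PMF α) (f : α → ℝ) : ℝ := ∑' a, (p a).toReal * f a

namespace PMF

variable {α β : Type*} [Finite α] [Finite β]

lemma sum_toReal_eq_one {α : Type*} [Fintype α] (p : PMF α) : ∑ a, (p a).toReal = 1 := by
  rw [← ENNReal.toReal_sum (fun a _ => p.apply_ne_top a), ← tsum_fintype (L := .unconditional _),
    p.tsum_coe, ENNReal.toReal_one]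

lemma mean_const (p : PMF α) (c : ℝ) : p.mean (fun _ => c) = c := by
  cases nonempty_fintype α
  rw [mean, tsum_fintype, ← Finset.sum_mul, sum_toReal_eq_one, one_mul]

lemma mean_mono (p : PMF α) {f g : α → ℝ} (h : ∀ a, f a ≤ g a) : p.mean f ≤ p.mean g := by
  cases nonempty_fintype α
  simp only [mean, tsum_fintype]
  exact Finset.sum_le_sum fun a _ => mul_le_mul_of_nonneg_left (h a) ENNReal.toReal_nonneg

lemma mean_add (p : PMF α) (f g : α → ℝ) : p.mean (fun a => f a + g a) = p.mean f + p.mean g := by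
  cases nonempty_fintype α
  simp only [mean, tsum_fintype, mul_add, Finset.sum_add_distrib]

lemma mean_sub (p : PMF α) (f g : α → ℝ) : p.mean (fun a => f a - g a) = p.mean f - p.mean g := by
  cases nonempty_fintype α
  simp only [mean, tsum_fintype, mul_sub, Finset.sum_sub_distrib]

lemma mean_const_mul (p : PMF α) (c : ℝ) (f : α → ℝ) :
    p.mean (fun a => c * f a) = c * p.mean f := by
  cases nonempty_fintype α
  simp only [mean, tsum_fintype, Finset.mul_sum, mul_left_comm]

lemma abs_mean_le (p : PMF α) {f : α → ℝ} {c : ℝ} (h : ∀ a, |f a| ≤ c) : |p.mean f| ≤ c := by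
  rw [abs_le]
  constructor
  · rw [← p.mean_const (-c)]
    exact p.mean_mono fun a => (abs_le.1 (h a)).1
  · rw [← p.mean_const c]
    exact p.mean_mono fun a => (abs_le.1 (h a)).2

lemma mean_pure (a : α) (f : α → ℝ) : (PMF.pure a).mean f = f a := by
  classical
  cases nonempty_fintype α
  rw [mean, tsum_fintype, Finset.sum_eq_single a] <;> simp +contextual [PMF.pure_apply]

lemma mean_bind (p : PMF α) (k : α → PMF β) (f : β → ℝ) :
    (p.bind k).mean f = p.mean fun a => (k a).mean f := by
  cases nonempty_fintype α
  cases nonempty_fintype β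
  simp only [mean, tsum_fintype, PMF.bind_apply, Finset.mul_sum]
  rw [Finset.sum_comm]
  refine Finset.sum_congr rfl fun b _ => ?_
  rw [ENNReal.toReal_sum fun a _ => ENNReal.mul_ne_top (p.apply_ne_top a) ((k a).apply_ne_top b),
    Finset.sum_mul]
  exact Finset.sum_congr rfl fun a _ => by rw [ENNReal.toReal_mul, mul_assoc]

lemma mean_map (p : PMF α) (g : α → β) (f : β → ℝ) :
    (p.map g).mean f = p.mean fun a => f (g a) := by
  rw [← PMF.bind_pure_comp, mean_bind]
  simp only [Function.comp_apply, mean_pure]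

end PMF

/-! ### Suprema over a finite type -/

lemma abs_ciSup_sub_ciSup_le {ι : Type*} [Finite ι] [Nonempty ι] {f g : ι → ℝ} {c : ℝ}
    (h : ∀ i, |f i - g i| ≤ c) : |(⨆ i, f i) - ⨆ i, g i| ≤ c := by
  have hf : BddAbove (Set.range f) := Set.finite_range f |>.bddAbove
  have hg : BddAbove (Set.range g) := Set.finite_range g |>.bddAbove
  rw [abs_sub_le_iff]
  constructor <;> rw [sub_le_iff_le_add]
  · exact ciSup_le fun i => by linarith [(abs_le.1 (h i)).2, le_ciSup hg i]
  · exact ciSup_le fun i => by linarith [(abs_le.1 (h i)).1, le_ciSup hf i]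

lemma abs_ciSup_le {ι : Type*} [Finite ι] [Nonempty ι] {f : ι → ℝ} {c : ℝ}
    (h : ∀ i, |f i| ≤ c) : |⨆ i, f i| ≤ c := by
  simpa using abs_ciSup_sub_ciSup_le (f := f) (g := fun _ => 0) (c := c) (by simpa using h)

/-! ### Discounted dynamic programming on a finite MDP -/

namespace MDP

variable {S A : Type*}

/-- The expectation of the reward plus the discounted continuation value `V` after playing `a`
in `s`. -/
def lookahead (M : MDP S A) (V : S → ℝ) (s : S) (a : A) : ℝ :=
  (M.prob s a).mean fun s' => M.reward s a s' + M.disc * V s'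

lemma optQ_eq_lookahead (M : MDP S A) : M.optQ = M.lookahead M.optValue := rfl

variable [Finite S]

lemma abs_lookahead_sub_le (M : MDP S A) {V V' : S → ℝ} {c : ℝ} (h : ∀ s, |V s - V' s| ≤ c)
    (s : S) (a : A) : |M.lookahead V s a - M.lookahead V' s a| ≤ M.disc * c := by
  rw [lookahead, lookahead, ← PMF.mean_sub]
  refine PMF.abs_mean_le _ fun s' => ?_
  rw [add_sub_add_left_eq_sub, ← mul_sub, abs_mul, abs_of_pos M.disc_pos]
  exact mul_le_mul_of_nonneg_left (h s') M.disc_pos.le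

lemma tendsto_disc_pow_mul_mean (M : MDP S A) (hdisc : M.disc < 1) (ρ : Policy S A) (s₀ : S)
    (V : S → ℝ) :
    Tendsto (fun n => M.disc ^ n * (M.stateLaw ρ s₀ n).mean V) atTop (𝓝 0) := by
  obtain ⟨C, hC⟩ := (Set.finite_range fun s => |V s|).bddAbove
  refine squeeze_zero_norm (a := fun n => M.disc ^ n * C) (fun n => ?_) ?_
  · rw [Real.norm_eq_abs, abs_mul, abs_of_pos (pow_pos M.disc_pos n)]
    exact mul_le_mul_of_nonneg_left (PMF.abs_mean_le _ fun s => hC ⟨s, rfl⟩)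
      (pow_pos M.disc_pos n).le
  · simpa using (tendsto_pow_atTop_nhds_zero_of_lt_one M.disc_pos.le hdisc).mul_const C

variable [Finite A]

lemma expReward_eq (M : MDP S A) (ρ : Policy S A) (s₀ : S) (k : ℕ) :
    M.expReward ρ s₀ k = (M.stateLaw ρ s₀ k).mean fun s => (ρ k s).mean fun a =>
      (M.prob s a).mean fun s' => M.reward s a s' := by
  change (M.stepLaw ρ s₀ k).mean (fun z => M.reward z.1 z.2.1 z.2.2) = _
  simp only [stepLaw, PMF.mean_bind, PMF.mean_map]

lemma mean_stateLaw_succ (M : MDP S A) (ρ : Policy S A) (s₀ : S) (k : ℕ) (V : S → ℝ) :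
    (M.stateLaw ρ s₀ (k + 1)).mean V = (M.stateLaw ρ s₀ k).mean fun s => (ρ k s).mean fun a =>
      (M.prob s a).mean V := by
  simp only [stateLaw, PMF.mean_bind]

lemma expReward_add_mean_stateLaw (M : MDP S A) (ρ : Policy S A) (s₀ : S) (k : ℕ) (V : S → ℝ) :
    M.expReward ρ s₀ k + M.disc * (M.stateLaw ρ s₀ (k + 1)).mean V =
      (M.stateLaw ρ s₀ k).mean fun s => (ρ k s).mean fun a => M.lookahead V s a := by
  rw [expReward_eq, mean_stateLaw_succ]
  simp only [lookahead, PMF.mean_add, PMF.mean_const_mul]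

lemma hasSum_value (M : MDP S A) (hdisc : M.disc < 1) (ρ : Policy S A) (s₀ : S) :
    HasSum (fun k => M.disc ^ k * M.expReward ρ s₀ k) (M.value ρ s₀) := by
  obtain ⟨C, hC⟩ := (Set.finite_range fun z : S × A × S => |M.reward z.1 z.2.1 z.2.2|).bddAbove
  refine Summable.hasSum (Summable.of_norm_bounded
    ((summable_geometric_of_lt_one M.disc_pos.le hdisc).mul_right C) fun k => ?_)
  rw [Real.norm_eq_abs, abs_mul, abs_of_pos (pow_pos M.disc_pos k)]
  refine mul_le_mul_of_nonneg_left ?_ (pow_pos M.disc_pos k).le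
  rw [expReward_eq]
  exact PMF.abs_mean_le _ fun s => PMF.abs_mean_le _ fun a => PMF.abs_mean_le _ fun s' =>
    hC ⟨(s, a, s'), rfl⟩

/-- A superharmonic function bounds the return of every policy: the discounted rewards telescope
against it. -/
lemma value_le_of_lookahead_le (M : MDP S A) (hdisc : M.disc < 1) {V : S → ℝ}
    (hV : ∀ s a, M.lookahead V s a ≤ V s) (ρ : Policy S A) (s₀ : S) : M.value ρ s₀ ≤ V s₀ := by
  have key (n : ℕ) : ∑ k ∈ Finset.range n, M.disc ^ k * M.expReward ρ s₀ k ≤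
      V s₀ - M.disc ^ n * (M.stateLaw ρ s₀ n).mean V := by
    induction n with
    | zero => simp [stateLaw, PMF.mean_pure]
    | succ n ih =>
      have h1 := M.expReward_add_mean_stateLaw ρ s₀ n V
      have h2 : ((M.stateLaw ρ s₀ n).mean fun s => (ρ n s).mean fun a => M.lookahead V s a) ≤
          (M.stateLaw ρ s₀ n).mean V := PMF.mean_mono _ fun s =>
        (PMF.mean_mono _ fun a => hV s a).trans_eq (PMF.mean_const _ _)
      have h3 := mul_le_mul_of_nonneg_left (h1.trans_le h2) (pow_pos M.disc_pos n).le
      rw [Finset.sum_range_succ, pow_succ]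
      linarith
  refine le_of_tendsto_of_tendsto' (M.hasSum_value hdisc ρ s₀).tendsto_sum_nat ?_ key
  simpa using (tendsto_const_nhds (x := V s₀)).sub (M.tendsto_disc_pow_mul_mean hdisc ρ s₀ V)

lemma value_ofMap_eq (M : MDP S A) (hdisc : M.disc < 1) {V : S → ℝ} {π : S → A}
    (hV : ∀ s, M.lookahead V s (π s) = V s) (s₀ : S) : M.value (Policy.ofMap π) s₀ = V s₀ := by
  set ρ := Policy.ofMap π with hρ
  have key (n : ℕ) : ∑ k ∈ Finset.range n, M.disc ^ k * M.expReward ρ s₀ k =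
      V s₀ - M.disc ^ n * (M.stateLaw ρ s₀ n).mean V := by
    induction n with
    | zero => simp [stateLaw, PMF.mean_pure]
    | succ n ih =>
      have h1 := M.expReward_add_mean_stateLaw ρ s₀ n V
      simp only [hρ, Policy.ofMap, PMF.mean_pure, hV] at h1
      rw [Finset.sum_range_succ, ih, pow_succ, eq_sub_of_add_eq h1]
      simp only [hρ]
      ring
  refine tendsto_nhds_unique (M.hasSum_value hdisc ρ s₀).tendsto_sum_nat ?_
  simp only [key]
  simpa using (tendsto_const_nhds (x := V s₀)).sub (M.tendsto_disc_pow_mul_mean hdisc ρ s₀ V)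

variable [Nonempty A]

/-- The Bellman operator is a contraction for the supremum norm, so it has a fixed point. -/
lemma exists_bellman_fixedPoint (M : MDP S A) (hdisc : M.disc < 1) :
    ∃ V : S → ℝ, ∀ s, V s = ⨆ a, M.lookahead V s a := by
  cases nonempty_fintype S
  let T : (S → ℝ) → S → ℝ := fun V s => ⨆ a, M.lookahead V s a
  have hT : ContractingWith ⟨M.disc, M.disc_pos.le⟩ T := by
    refine ⟨hdisc, LipschitzWith.of_dist_le_mul fun V V' => ?_⟩
    refine (dist_pi_le_iff (mul_nonneg M.disc_pos.le dist_nonneg)).2 fun s => ?_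
    exact abs_ciSup_sub_ciSup_le fun a => M.abs_lookahead_sub_le (fun s' => dist_le_pi_dist V V' s')
      s a
  exact ⟨hT.fixedPoint, fun s => (congrFun hT.fixedPoint_isFixedPt s).symm⟩

lemma eq_optValue_of_bellman (M : MDP S A) (hdisc : M.disc < 1) {V : S → ℝ}
    (hV : ∀ s, V s = ⨆ a, M.lookahead V s a) : V = M.optValue := by
  have hle (s : S) (a : A) : M.lookahead V s a ≤ V s := by
    rw [hV s]
    exact le_ciSup (f := M.lookahead V s) (Set.finite_range _).bddAbove a
  have hgreedy (s : S) : ∃ a, M.lookahead V s a = V s := by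
    rw [hV s]
    exact exists_eq_ciSup_of_finite
  choose π hπ using hgreedy
  have hbound (ρ : Policy S A) (s : S) := M.value_le_of_lookahead_le hdisc hle ρ s
  have : Nonempty (Policy S A) := ⟨Policy.ofMap π⟩
  ext s
  refine le_antisymm ?_ (ciSup_le fun ρ => hbound ρ s)
  rw [← M.value_ofMap_eq hdisc hπ s]
  exact le_ciSup (f := fun ρ => M.value ρ s) ⟨V s, by rintro _ ⟨ρ, rfl⟩; exact hbound ρ s⟩ _

lemma optValue_eq_ciSup_optQ (M : MDP S A) (hdisc : M.disc < 1) (s : S) :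
    M.optValue s = ⨆ a, M.optQ s a := by
  obtain ⟨V, hV⟩ := M.exists_bellman_fixedPoint hdisc
  rw [optQ_eq_lookahead, ← M.eq_optValue_of_bellman hdisc hV]
  exact hV s

lemma optQ_le_optValue (M : MDP S A) (hdisc : M.disc < 1) (s : S) (a : A) :
    M.optQ s a ≤ M.optValue s := by
  rw [M.optValue_eq_ciSup_optQ hdisc]
  exact le_ciSup (f := M.optQ s) (Set.finite_range _).bddAbove a

lemma isOptimal_ofMap_of_greedy (M : MDP S A) (hdisc : M.disc < 1) {π : S → A}
    (hπ : ∀ s a, M.optQ s a ≤ M.optQ s (π s)) : M.IsOptimal (Policy.ofMap π) := by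
  intro s₀ ρ
  rw [M.value_ofMap_eq hdisc (V := M.optValue)]
  · exact M.value_le_of_lookahead_le hdisc (M.optQ_le_optValue hdisc) ρ s₀
  · refine fun s => le_antisymm (M.optQ_le_optValue hdisc s _) ?_
    rw [M.optValue_eq_ciSup_optQ hdisc]
    exact ciSup_le (hπ s)

end MDP

/-! ### The product of an MDP and a reward machine -/

section ProductLemmas

variable {X U Δ : Type*} [Finite U] [Nonempty U]

/-- The target contracts the supremum norm over the non-terminal entries, the only ones it reads. -/
lemma abs_qTarget_sub_le (R : PRM Δ) (L : X → Set Δ) {disc : ℝ} (hdisc : 0 ≤ disc)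
    {q q' : X → R.Ω → U → ℝ} {c : ℝ} (hc : 0 ≤ c)
    (h : ∀ y σ v, σ ∉ R.terminal → |q y σ v - q' y σ v| ≤ c) (x' : X) (ϱ : R.Ω) :
    |qTarget R L disc q x' ϱ - qTarget R L disc q' x' ϱ| ≤ disc * c := by
  unfold qTarget
  split_ifs with hτ
  · simpa using mul_nonneg hdisc hc
  · rw [add_sub_add_left_eq_sub, ← mul_sub, abs_mul, abs_of_nonneg hdisc]
    exact mul_le_mul_of_nonneg_left (abs_ciSup_sub_ciSup_le fun v => h _ _ v hτ) hdisc

lemma abs_qTarget_le (R : PRM Δ) (L : X → Set Δ) {disc : ℝ} (hdisc : 0 ≤ disc)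
    {q : X → R.Ω → U → ℝ} {B C : ℝ} (hB : ∀ y σ v, |q y σ v| ≤ B) (hB0 : 0 ≤ B)
    {x' : X} {ϱ : R.Ω} (hC : |R.δr ϱ (L x')| ≤ C) : |qTarget R L disc q x' ϱ| ≤ C + disc * B := by
  unfold qTarget
  split_ifs with hτ
  · linarith [mul_nonneg hdisc hB0]
  · refine (abs_add_le _ _).trans (add_le_add hC ?_)
    rw [abs_mul, abs_of_nonneg hdisc]
    exact mul_le_mul_of_nonneg_left (abs_ciSup_le fun v => hB _ _ v) hdisc

variable [Finite X]

lemma MDP.optValue_product_terminal (M : MDP X U) (hdisc : M.disc < 1) (R : PRM Δ) [Finite R.Ω]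
    (L : X → Set Δ) {σ : R.Ω} (hσ : σ ∈ R.terminal) (y : X) :
    (M.product R L).optValue (y, σ) = 0 := by
  set V := (M.product R L).optValue with hV
  obtain ⟨c, hc⟩ := (Set.finite_range fun y => |V (y, σ)|).bddAbove
  -- From a terminal state, `V` is bounded by `λ ^ n * c` for every `n`.
  have key (n : ℕ) : ∀ y, |V (y, σ)| ≤ M.disc ^ n * c := by
    induction n with
    | zero => exact fun y => by simpa using hc ⟨y, rfl⟩
    | succ n ih =>
      intro y
      rw [hV, (M.product R L).optValue_eq_ciSup_optQ hdisc]
      refine abs_ciSup_le fun v => ?_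
      rw [MDP.optQ_eq_lookahead, MDP.lookahead]
      simp only [MDP.product, PMF.mean_map, hσ, if_true, zero_add]
      rw [PMF.mean_const_mul, abs_mul, abs_of_pos M.disc_pos, pow_succ', mul_assoc]
      exact mul_le_mul_of_nonneg_left (PMF.abs_mean_le _ fun x' => ih x') M.disc_pos.le
  have hlim : Tendsto (fun n => M.disc ^ n * c) atTop (𝓝 0) := by
    simpa using (tendsto_pow_atTop_nhds_zero_of_lt_one M.disc_pos.le hdisc).mul_const c
  exact abs_eq_zero.1 (le_antisymm (ge_of_tendsto' hlim fun n => key n y) (abs_nonneg _))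

lemma MDP.optQ_product_terminal (M : MDP X U) (hdisc : M.disc < 1) (R : PRM Δ) [Finite R.Ω]
    (L : X → Set Δ) {σ : R.Ω} (hσ : σ ∈ R.terminal) (y : X) (v : U) :
    (M.product R L).optQ (y, σ) v = 0 := by
  have h := fun x' => M.optValue_product_terminal hdisc R L hσ x'
  rw [MDP.optQ_eq_lookahead, MDP.lookahead]
  simp only [MDP.product, PMF.mean_map, hσ, if_true, zero_add] at h ⊢
  simp only [h, mul_zero, PMF.mean_const]

/-- At non-terminal machine states the optimal state-action values are a fixed point of the
expected Q-learning target. -/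
lemma MDP.optQ_product_eq_mean_qTarget (M : MDP X U) (hdisc : M.disc < 1) (R : PRM Δ) [Finite R.Ω]
    (L : X → Set Δ) {σ : R.Ω} (hσ : σ ∉ R.terminal) (y : X) (v : U) :
    (M.product R L).optQ (y, σ) v =
      (M.prob y v).mean fun x' =>
        qTarget R L M.disc (fun y σ v => (M.product R L).optQ (y, σ) v) x' σ := by
  have h1 := (M.product R L).optValue_eq_ciSup_optQ hdisc
  have h0 := fun τ hτ x' => M.optValue_product_terminal hdisc R L (σ := τ) hτ x'
  conv_lhs => rw [MDP.optQ_eq_lookahead, MDP.lookahead]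
  have hp : (M.product R L).prob (y, σ) v = (M.prob y v).map fun x' => (x', R.δϱ σ (L x')) := by
    simp only [MDP.product, hσ, if_false]
  have hr (x') : (M.product R L).reward (y, σ) v x' = R.δr σ (L x'.1) := by
    simp only [MDP.product, hσ, if_false]
  rw [hp, PMF.mean_map]
  congr 1
  ext x'
  rw [hr, qTarget]
  split_ifs with hτ
  · simp [h0 _ hτ x']
  · rw [h1]; rfl

end ProductLemmas

/-! ### Deterministic convergence of asynchronous contracting recursions -/

/-- Averaging towards levels below `c` with divergent total weight eventually pushes the sequence
below every level above `c`. -/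
lemma eventually_le_of_averaging {a α : ℕ → ℝ} {c : ℝ} (hα : ∀ t, α t ∈ Set.Icc (0 : ℝ) 1)
    (hsum : Tendsto (fun n => ∑ t ∈ Finset.range n, α t) atTop atTop)
    (ha : ∀ᶠ t in atTop, a (t + 1) ≤ (1 - α t) * a t + α t * c) {ε : ℝ} (hε : 0 < ε) :
    ∀ᶠ t in atTop, a t ≤ c + ε := by
  obtain ⟨T, hT⟩ := eventually_atTop.1 ha
  set S : ℕ → ℝ := fun n => ∑ t ∈ Finset.range n, α t with hS
  set K := max (a T - c) 0 with hK
  have key (t : ℕ) (ht : T ≤ t) : a t - c ≤ Real.exp (S T - S t) * K := by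
    induction t, ht using Nat.le_induction with
    | base => simp [hK]
    | succ t ht ih =>
      have h1 := hT t ht
      have h2 : 1 - α t ≤ Real.exp (-α t) := by linarith [Real.add_one_le_exp (-α t)]
      have h3 : S T - S (t + 1) = -α t + (S T - S t) := by
        simp only [hS, Finset.sum_range_succ]; ring
      calc a (t + 1) - c ≤ (1 - α t) * (a t - c) := by linarith
        _ ≤ (1 - α t) * (Real.exp (S T - S t) * K) :=
          mul_le_mul_of_nonneg_left ih (by linarith [(hα t).2])
        _ ≤ Real.exp (-α t) * (Real.exp (S T - S t) * K) :=
          mul_le_mul_of_nonneg_right h2 (by positivity)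
        _ = _ := by rw [h3, Real.exp_add, mul_assoc]
  have hlim : Tendsto (fun t => Real.exp (S T - S t) * K) atTop (𝓝 0) := by
    have h : Tendsto (fun t => S T - S t) atTop atBot :=
      tendsto_atBot_add_const_left _ _ (tendsto_neg_atTop_atBot.comp hsum)
    simpa using (Real.tendsto_exp_atBot.comp h).mul_const K
  filter_upwards [hlim.eventually (gt_mem_nhds hε), eventually_ge_atTop T] with t h1 h2
  linarith [key t h2]

/-- An asynchronous stochastic-approximation recursion on one sample path: if the drift `F`
contracts the supremum norm, the steps `α` have divergent sums and the noise `n` has convergent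
sums, then a bounded solution tends to zero. Adding the tail sums of the noise to the solution
turns the recursion into a noiseless one. -/
theorem tendsto_zero_of_contracting_recursion {ι : Type*} [Finite ι] {D F n α : ℕ → ι → ℝ}
    {γ B : ℝ} (hγ0 : 0 ≤ γ) (hγ1 : γ < 1)
    (hα : ∀ t i, α t i ∈ Set.Icc (0 : ℝ) 1)
    (hsum : ∀ i, Tendsto (fun N => ∑ t ∈ Finset.range N, α t i) atTop atTop)
    (hrec : ∀ t i, D (t + 1) i = (1 - α t i) * D t i + α t i * F t i + n t i)
    (hF : ∀ t c, (∀ j, |D t j| ≤ c) → ∀ i, |F t i| ≤ γ * c)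
    (hn : ∀ i, ∃ l, Tendsto (fun N => ∑ t ∈ Finset.range N, n t i) atTop (𝓝 l))
    (hB : ∀ t i, |D t i| ≤ B) (i : ι) : Tendsto (fun t => D t i) atTop (𝓝 0) := by
  choose l hl using hn
  set s : ℕ → ι → ℝ := fun t i => l i - ∑ k ∈ Finset.range t, n k i with hs
  have hs0 (i) : Tendsto (fun t => s t i) atTop (𝓝 0) := by
    simpa using (tendsto_const_nhds (x := l i)).sub (hl i)
  have hsmall {δ : ℝ} (hδ : 0 < δ) : ∀ᶠ t in atTop, ∀ i, |s t i| ≤ δ := by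
    refine eventually_all.2 fun i => ?_
    filter_upwards [(hs0 i).eventually (Metric.closedBall_mem_nhds 0 hδ)] with t ht
    simpa [Real.norm_eq_abs] using ht
  set z : ℕ → ι → ℝ := fun t i => D t i + s t i with hz
  have hzrec (t i) : z (t + 1) i = (1 - α t i) * z t i + α t i * (F t i + s t i) := by
    simp only [hz, hs, hrec, Finset.sum_range_succ]; ring
  have step {c ε : ℝ} (hε : 0 < ε) (hc : ∀ᶠ t in atTop, ∀ i, |z t i| ≤ c) :
      ∀ᶠ t in atTop, ∀ i, |z t i| ≤ γ * c + ε := by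
    refine eventually_all.2 fun i => ?_
    have h : ∀ᶠ t in atTop,
        |z (t + 1) i| ≤ (1 - α t i) * |z t i| + α t i * (γ * c + ε / 2) := by
      filter_upwards [hc, hsmall (δ := ε / 4) (by linarith)] with t h1 h2
      have hD (j) : |D t j| ≤ c + ε / 4 := by
        have : D t j = z t j - s t j := by simp [hz]
        rw [this]
        exact (abs_sub _ _).trans (add_le_add (h1 j) (h2 j))
      have hFs : |F t i + s t i| ≤ γ * c + ε / 2 := by
        refine (abs_add_le _ _).trans ((add_le_add (hF t _ hD i) (h2 i)).trans ?_)
        nlinarith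
      rw [hzrec]
      refine (abs_add_le _ _).trans (add_le_add ?_ ?_)
      · rw [abs_mul, abs_of_nonneg (sub_nonneg.2 (hα t i).2)]
      · rw [abs_mul, abs_of_nonneg (hα t i).1]
        exact mul_le_mul_of_nonneg_left hFs (hα t i).1
    filter_upwards [eventually_le_of_averaging (a := fun t => |z t i|) (fun t => hα t i) (hsum i) h
      (ε := ε / 2) (by linarith)] with t ht
    linarith
  -- Spending half of the contraction margin on `ε`, each application of `step` shrinks the
  -- eventual bound by the factor `(1 + γ) / 2`.
  have hB0 : 0 ≤ B := (abs_nonneg _).trans (hB 0 i)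
  have geom (k : ℕ) : ∀ᶠ t in atTop, ∀ i, |z t i| ≤ ((1 + γ) / 2) ^ k * (B + 1) := by
    induction k with
    | zero =>
      filter_upwards [hsmall one_pos] with t ht i
      simpa using (abs_add_le _ _).trans (add_le_add (hB t i) (ht i))
    | succ k ih =>
      have hpos : 0 < ((1 + γ) / 2) ^ k * (B + 1) := by positivity
      filter_upwards [step (ε := (1 - γ) / 2 * (((1 + γ) / 2) ^ k * (B + 1)))
        (mul_pos (by linarith) hpos) ih] with t ht i
      refine (ht i).trans_eq ?_
      ring
  have hlim : Tendsto (fun k => ((1 + γ) / 2) ^ k * (B + 1)) atTop (𝓝 0) := by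
    simpa using (tendsto_pow_atTop_nhds_zero_of_lt_one (by positivity)
      (by linarith : (1 + γ) / 2 < 1)).mul_const (B + 1)
  have hz0 : Tendsto (fun t => z t i) atTop (𝓝 0) := by
    refine Metric.tendsto_nhds.2 fun ε hε => ?_
    obtain ⟨k, hk⟩ := (hlim.eventually (gt_mem_nhds hε)).exists
    filter_upwards [geom k] with t ht
    simpa [Real.dist_eq] using (ht i).trans_lt hk
  simpa [hz] using hz0.sub (hs0 i)

/-! ### Almost sure convergence of square-summable noise -/

/-- A series of martingale differences whose squares have uniformly bounded sums converges almost
surely: by orthogonality of the increments the partial sums are bounded in `L²`. -/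
theorem ae_exists_tendsto_sum_of_sq_sum_le {W : Type*} {mW : MeasurableSpace W} {μ : Measure W}
    [IsProbabilityMeasure μ] {ℱ : Filtration ℕ mW} {ξ : ℕ → W → ℝ} {C : ℝ}
    (hmeas : ∀ t, StronglyMeasurable[ℱ (t + 1)] (ξ t))
    (hcond : ∀ t, μ[ξ t | ℱ t] =ᵐ[μ] 0)
    (hC : ∀ n w, ∑ t ∈ Finset.range n, ξ t w ^ 2 ≤ C) :
    ∀ᵐ w ∂μ, ∃ l, Tendsto (fun n => ∑ t ∈ Finset.range n, ξ t w) atTop (𝓝 l) := by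
  have hC0 : 0 ≤ C := by
    obtain ⟨w⟩ := nonempty_of_isProbabilityMeasure μ
    simpa using hC 0 w
  have hξb (t w) : |ξ t w| ≤ √C := by
    refine Real.abs_le_sqrt ((Finset.single_le_sum (f := fun t => ξ t w ^ 2)
      (fun k _ => sq_nonneg _) (Finset.self_mem_range_succ t)).trans (hC (t + 1) w))
  have hξm (t) : AEStronglyMeasurable (ξ t) μ :=
    ((hmeas t).mono (ℱ.le (t + 1))).aestronglyMeasurable
  have hξi (t) : Integrable (ξ t) μ :=
    Integrable.of_bound (hξm t) (√C) (ae_of_all _ fun w => hξb t w)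
  set S : ℕ → W → ℝ := fun n => ∑ t ∈ Finset.range n, ξ t with hS
  have hSm (n) : StronglyMeasurable[ℱ n] (S n) :=
    Finset.stronglyMeasurable_sum _ fun t ht =>
      (hmeas t).mono (ℱ.mono (Nat.succ_le_of_lt (Finset.mem_range.1 ht)))
  have hSb (n w) : |S n w| ≤ n * √C := by
    simp only [hS, Finset.sum_apply]
    refine (Finset.abs_sum_le_sum_abs _ _).trans ((Finset.sum_le_sum fun t _ => hξb t w).trans ?_)
    simp
  have hSm' (n) : AEStronglyMeasurable (S n) μ := ((hSm n).mono (ℱ.le n)).aestronglyMeasurable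
  have hSi (n) : Integrable (S n) μ :=
    Integrable.of_bound (hSm' n) (n * √C) (ae_of_all _ fun w => hSb n w)
  have hmart : Martingale S ℱ μ := by
    refine martingale_of_condExp_sub_eq_zero_nat hSm hSi fun n => ?_
    have : S (n + 1) - S n = ξ n := by simp [hS, Finset.sum_range_succ]
    rw [this]
    exact hcond n
  have hSξ (n) : Integrable (S n * ξ n) μ := (hξi n).bdd_mul (hSm' n) (ae_of_all _ fun w => hSb n w)
  have horth (n) : ∫ w, S n w * ξ n w ∂μ = 0 := by
    have h := condExp_mul_of_stronglyMeasurable_left (hSm n) (hSξ n) (hξi n)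
    have h2 : ∫ w, (S n * ξ n) w ∂μ = 0 := by
      rw [← integral_condExp (ℱ.le n), integral_congr_ae h, ← integral_zero W ℝ (μ := μ)]
      refine integral_congr_ae ?_
      filter_upwards [hcond n] with w hw
      simp [hw]
    exact h2
  have hξ2 (n) : Integrable (fun w => ξ n w ^ 2) μ := by
    simp only [sq]
    exact (hξi n).bdd_mul (hξm n) (ae_of_all _ fun w => hξb n w)
  have hS2 (n) : Integrable (fun w => S n w ^ 2) μ := by
    simp only [sq]
    exact (hSi n).bdd_mul (hSm' n) (ae_of_all _ fun w => hSb n w)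
  have hsq (n) : ∫ w, S n w ^ 2 ∂μ = ∑ t ∈ Finset.range n, ∫ w, ξ t w ^ 2 ∂μ := by
    induction n with
    | zero => simp [hS]
    | succ n ih =>
      have h : (fun w => S (n + 1) w ^ 2) =
          fun w => (S n w ^ 2 + 2 * (S n w * ξ n w)) + ξ n w ^ 2 := by
        ext w
        simp only [hS, Finset.sum_range_succ, Pi.add_apply]
        ring
      have h2 : Integrable (fun w => 2 * (S n w * ξ n w)) μ := (hSξ n).const_mul 2
      have h3 : Integrable (fun w => S n w ^ 2 + 2 * (S n w * ξ n w)) μ := (hS2 n).add h2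
      rw [h, integral_add h3 (hξ2 n), integral_add (hS2 n) h2, integral_const_mul,
        horth, Finset.sum_range_succ, ih]
      ring
  have hsq_le (n) : ∫ w, S n w ^ 2 ∂μ ≤ C := by
    rw [hsq, ← integral_finsetSum _ fun t _ => hξ2 t]
    refine (integral_mono (integrable_finsetSum _ fun t _ => hξ2 t) (integrable_const C)
      fun w => hC n w).trans_eq ?_
    simp
  have hL1 (n) : eLpNorm (S n) 1 μ ≤ (Real.toNNReal (1 + C) : NNReal) := by
    rw [eLpNorm_one_eq_lintegral_enorm, ← ofReal_integral_norm_eq_lintegral_enorm (hSi n)]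
    refine ENNReal.ofReal_le_ofReal ?_
    have h : ∫ w, ‖S n w‖ ∂μ ≤ ∫ w, (1 + S n w ^ 2) ∂μ :=
      integral_mono (hSi n).norm ((integrable_const 1).add (hS2 n)) fun w => by
        simp only [Real.norm_eq_abs]
        nlinarith [sq_nonneg (|S n w| - 1), sq_abs (S n w)]
    rw [integral_add (integrable_const 1) (hS2 n)] at h
    simp only [integral_const, probReal_univ, smul_eq_mul, mul_one] at h
    linarith [hsq_le n]
  filter_upwards [hmart.submartingale.exists_ae_tendsto_of_bdd hL1] with w hw
  simpa [hS] using hw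

/-- Given the past `m`, the deviation of a sampled payoff from its expectation under the sampling
law has mean zero, when the payoffs are known in the past. -/
lemma condExp_sample_sub_mean {W A : Type*} [Finite A] {m mW : MeasurableSpace W} {μ : Measure W}
    [IsProbabilityMeasure μ] (hm : m ≤ mW) {X : W → A} (hX : Measurable[mW, ⊤] X) {P : W → PMF A}
    (hP : ∀ a, StronglyMeasurable[m] fun w => (P w a).toReal)
    (hXP : ∀ a, μ[Set.indicator {w | X w = a} (fun _ => (1 : ℝ)) | m]
      =ᵐ[μ] fun w => (P w a).toReal)
    {g : A → W → ℝ} {C : ℝ} (hg : ∀ a, StronglyMeasurable[m] (g a)) (hC : ∀ a w, |g a w| ≤ C) :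
    μ[fun w => g (X w) w - (P w).mean fun a => g a w | m] =ᵐ[μ] 0 := by
  classical
  cases nonempty_fintype A
  set I : A → W → ℝ := fun a => Set.indicator {w | X w = a} (fun _ => (1 : ℝ)) with hI
  have hsampled : (fun w => g (X w) w) = ∑ a, g a * I a := by
    ext w
    simp [hI, Set.indicator_apply]
  have hmean : (fun w => (P w).mean fun a => g a w) = ∑ a, g a * fun w => (P w a).toReal := by
    ext w
    simp [PMF.mean, tsum_fintype, mul_comm]
  have hIi (a) : Integrable (I a) μ :=
    (integrable_const 1).indicator (hX (MeasurableSpace.measurableSet_top (s := {a})))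
  have hPi (a) : Integrable (fun w => (P w a).toReal) μ :=
    Integrable.of_bound ((hP a).mono hm).aestronglyMeasurable 1 (ae_of_all _ fun w => by
      rw [Real.norm_eq_abs, abs_of_nonneg ENNReal.toReal_nonneg]
      exact ENNReal.toReal_mono ENNReal.one_ne_top ((P w).coe_le_one a))
  have hgI (a) : Integrable (g a * I a) μ :=
    (hIi a).bdd_mul ((hg a).mono hm).aestronglyMeasurable (ae_of_all _ fun w => hC a w)
  have hgP (a) : Integrable (g a * fun w => (P w a).toReal) μ :=
    (hPi a).bdd_mul ((hg a).mono hm).aestronglyMeasurable (ae_of_all _ fun w => hC a w)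
  have hterm (a) : μ[g a * I a | m] =ᵐ[μ] g a * fun w => (P w a).toReal := by
    refine (condExp_mul_of_stronglyMeasurable_left (hg a) (hgI a) (hIi a)).trans ?_
    filter_upwards [hXP a] with w hw
    simp only [Pi.mul_apply]
    rw [hw]
  have h1 : μ[∑ a, g a * I a | m] =ᵐ[μ] ∑ a, g a * fun w => (P w a).toReal := by
    refine (condExp_finsetSum (fun a _ => hgI a) m).trans ?_
    filter_upwards [ae_all_iff.2 hterm] with w hw
    simp only [Finset.sum_apply]
    exact Finset.sum_congr rfl fun a _ => hw a
  have h2 : μ[∑ a, g a * fun w => (P w a).toReal | m] = ∑ a, g a * fun w => (P w a).toReal :=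
    condExp_of_stronglyMeasurable hm (Finset.stronglyMeasurable_sum _ fun a _ => (hg a).mul (hP a))
      (integrable_finsetSum' _ fun a _ => hgP a)
  have h3 : (fun w => g (X w) w - (P w).mean fun a => g a w) =
      (∑ a, g a * I a) - ∑ a, g a * fun w => (P w a).toReal := by
    rw [← hsampled, ← hmean]; rfl
  rw [h3]
  refine (condExp_sub (integrable_finsetSum' _ fun a _ => hgI a)
    (integrable_finsetSum' _ fun a _ => hgP a) m).trans ?_
  rw [h2]
  filter_upwards [h1] with w hw
  simp [hw]

/-- Every function of a countably valued and an arbitrary variable, both measurable for the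
discrete `σ`-algebra, is measurable for the discrete `σ`-algebra. -/
lemma measurable_top_map₂ {W A B C : Type*} [Countable A] {m : MeasurableSpace W} {f : W → A}
    {g : W → B} (hf : Measurable[m, ⊤] f) (hg : Measurable[m, ⊤] g) (h : A → B → C) :
    Measurable[m, ⊤] fun w => h (f w) (g w) := by
  intro s _
  have : (fun w => h (f w) (g w)) ⁻¹' s = ⋃ a, f ⁻¹' {a} ∩ g ⁻¹' {b | h a b ∈ s} := by
    ext w; simp
  rw [this]
  exact MeasurableSet.iUnion fun a =>
    (hf (MeasurableSpace.measurableSet_top)).inter (hg (MeasurableSpace.measurableSet_top))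

/-! ### One pass through the pool of experiences -/

section Loop

variable {X U Δ : Type*}

open Classical in
/-- The rate at which a pass through the pool `l`, for the observed state `x` and action `u`, moves
the entry `(y, σ, v)`; it is `0` if the pass does not update that entry. -/
def loopRate {R : PRM Δ} (κ : X → R.Ω → U → ℕ → ℝ) (x : X) (u : U) (l : List R.Ω)
    (m : Memory X U R) (y : X) (σ : R.Ω) (v : U) : ℝ :=
  if y = x ∧ σ ∈ l ∧ v = u then κ y σ v (m.count y σ v) else 0

variable {R : PRM Δ} {L : X → Set Δ} {disc : ℝ} {κ : X → R.Ω → U → ℕ → ℝ} {x x' : X} {u : U}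

lemma foldl_updateEntry_of_not {l : List R.Ω} {m : Memory X U R} {y : X} {σ : R.Ω} {v : U}
    (h : ¬(y = x ∧ σ ∈ l ∧ v = u)) :
    (l.foldl (updateEntry R L disc κ x u x') m).q y σ v = m.q y σ v ∧
      (l.foldl (updateEntry R L disc κ x u x') m).count y σ v = m.count y σ v := by
  induction l generalizing m with
  | nil => exact ⟨rfl, rfl⟩
  | cons τ l ih =>
    have h1 : ¬(y = x ∧ σ ∈ l ∧ v = u) := fun h' => h ⟨h'.1, List.mem_cons_of_mem _ h'.2.1, h'.2.2⟩
    have h2 : ¬(y = x ∧ σ = τ ∧ v = u) := by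
      rintro ⟨rfl, rfl, rfl⟩
      exact h ⟨rfl, List.mem_cons_self, rfl⟩
    obtain ⟨h3, h4⟩ := ih (m := updateEntry R L disc κ x u x' m τ) h1
    rw [List.foldl_cons, h3, h4]
    simp only [updateEntry, if_neg h2, and_self]

/-- An entry that occurs in the pool is updated once, from its old value and towards the target
computed with the table `q̃` that the earlier part of the pool has produced. -/
lemma foldl_updateEntry_of_mem {l : List R.Ω} (hl : l.Nodup) (m : Memory X U R) {σ : R.Ω}
    (hσ : σ ∈ l) :
    (l.foldl (updateEntry R L disc κ x u x') m).count x σ u = m.count x σ u + 1 ∧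
    ∃ l₁ : List R.Ω, l₁ <+: l ∧
      (l.foldl (updateEntry R L disc κ x u x') m).q x σ u = m.q x σ u +
        κ x σ u (m.count x σ u) *
          (qTarget R L disc (l₁.foldl (updateEntry R L disc κ x u x') m).q x' σ - m.q x σ u) := by
  obtain ⟨l₁, l₂, rfl⟩ := List.append_of_mem hσ
  have h₁ : σ ∉ l₁ := fun h => (List.nodup_append.1 hl).2.2 σ h σ List.mem_cons_self rfl
  have h₂ : σ ∉ l₂ := (List.nodup_cons.1 (List.nodup_append.1 hl).2.1).1
  obtain ⟨a1, a2⟩ := foldl_updateEntry_of_not (L := L) (disc := disc) (κ := κ) (x' := x')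
    (m := m) (l := l₁) (y := x) (x := x) (v := u) (u := u) fun h => h₁ h.2.1
  rw [List.foldl_append, List.foldl_cons]
  obtain ⟨b1, b2⟩ := foldl_updateEntry_of_not (L := L) (disc := disc) (κ := κ) (x' := x')
    (m := updateEntry R L disc κ x u x' (l₁.foldl (updateEntry R L disc κ x u x') m) σ)
    (l := l₂) (y := x) (x := x) (v := u) (u := u) fun h => h₂ h.2.1
  refine ⟨?_, l₁, List.prefix_append _ _, ?_⟩
  · rw [b2]
    simp [updateEntry, a2]
  · rw [b1]
    simp [updateEntry, a1, a2]

lemma loopRate_mem_Icc (hκ : ∀ x ϱ u n, κ x ϱ u n ∈ Set.Icc (0 : ℝ) 1) (l : List R.Ω)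
    (m : Memory X U R) (y : X) (σ : R.Ω) (v : U) :
    loopRate κ x u l m y σ v ∈ Set.Icc (0 : ℝ) 1 := by
  unfold loopRate
  split_ifs
  exacts [hκ _ _ _ _, ⟨le_rfl, zero_le_one⟩]

variable {B : ℝ}

/-- The updates are convex combinations, so a bound that is preserved by the targets is preserved
by the loop. -/
lemma abs_foldl_updateEntry_le (hκ : ∀ x ϱ u n, κ x ϱ u n ∈ Set.Icc (0 : ℝ) 1)
    (hB : ∀ q : X → R.Ω → U → ℝ, (∀ y σ v, |q y σ v| ≤ B) → ∀ y σ, |qTarget R L disc q y σ| ≤ B)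
    (l : List R.Ω) {m : Memory X U R} (hm : ∀ y σ v, |m.q y σ v| ≤ B) (y : X) (σ : R.Ω) (v : U) :
    |(l.foldl (updateEntry R L disc κ x u x') m).q y σ v| ≤ B := by
  induction l generalizing m with
  | nil => exact hm y σ v
  | cons τ l ih =>
    refine ih fun y σ v => ?_
    simp only [updateEntry]
    split_ifs
    · have h1 := hm x τ u
      have h2 := hB m.q hm x' τ
      obtain ⟨h3, h4⟩ := hκ x τ u (m.count x τ u)
      rw [abs_le] at h1 h2 ⊢
      constructor <;> nlinarith
    · exact hm y σ v

lemma abs_foldl_updateEntry_sub_le (hκ : ∀ x ϱ u n, κ x ϱ u n ∈ Set.Icc (0 : ℝ) 1)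
    (hB : ∀ q : X → R.Ω → U → ℝ, (∀ y σ v, |q y σ v| ≤ B) → ∀ y σ, |qTarget R L disc q y σ| ≤ B)
    {l : List R.Ω} (hl : l.Nodup) {m : Memory X U R} (hm : ∀ y σ v, |m.q y σ v| ≤ B)
    (y : X) (σ : R.Ω) (v : U) :
    |(l.foldl (updateEntry R L disc κ x u x') m).q y σ v - m.q y σ v| ≤
      loopRate κ x u l m y σ v * (2 * B) := by
  unfold loopRate
  split_ifs with h
  · obtain ⟨rfl, hσ, rfl⟩ := h
    obtain ⟨-, l₁, -, h₁⟩ := foldl_updateEntry_of_mem (L := L) (disc := disc) (κ := κ) (x := y)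
      (x' := x') (u := v) hl m hσ
    rw [h₁, add_sub_cancel_left, abs_mul, abs_of_nonneg (hκ _ _ _ _).1]
    refine mul_le_mul_of_nonneg_left ((abs_sub _ _).trans ?_) (hκ _ _ _ _).1
    linarith [hm y σ v, hB _ (abs_foldl_updateEntry_le (x := y) (x' := x') (u := v) hκ hB l₁ hm)
      x' σ]
  · simp [(foldl_updateEntry_of_not (L := L) (disc := disc) (κ := κ) (x' := x') (m := m) h).1]

/-- A pass through the pool is a step of asynchronous Q-learning, up to replacing the old table
in the target by a table `q̃` that differs from it by at most a multiple of the learning rates. -/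
lemma exists_foldl_updateEntry_eq (hκ : ∀ x ϱ u n, κ x ϱ u n ∈ Set.Icc (0 : ℝ) 1)
    (hB : ∀ q : X → R.Ω → U → ℝ, (∀ y σ v, |q y σ v| ≤ B) → ∀ y σ, |qTarget R L disc q y σ| ≤ B)
    {l : List R.Ω} (hl : l.Nodup) {m : Memory X U R} (hm : ∀ y σ v, |m.q y σ v| ≤ B)
    (y : X) (σ : R.Ω) (v : U) :
    ∃ q' : X → R.Ω → U → ℝ,
      (l.foldl (updateEntry R L disc κ x u x') m).q y σ v = m.q y σ v +
        loopRate κ x u l m y σ v * (qTarget R L disc q' x' σ - m.q y σ v) ∧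
      ∀ z τ a, |q' z τ a - m.q z τ a| ≤ loopRate κ x u l m z τ a * (2 * B) := by
  by_cases h : y = x ∧ σ ∈ l ∧ v = u
  · obtain ⟨rfl, hσ, rfl⟩ := h
    obtain ⟨-, l₁, hpre, h₁⟩ := foldl_updateEntry_of_mem (L := L) (disc := disc) (κ := κ) (x := y)
      (x' := x') (u := v) hl m hσ
    refine ⟨_, by rw [h₁, loopRate, if_pos ⟨rfl, hσ, rfl⟩], fun z τ a => ?_⟩
    refine (abs_foldl_updateEntry_sub_le hκ hB (hl.sublist hpre.sublist) hm z τ a).trans ?_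
    refine mul_le_mul_of_nonneg_right ?_ (by linarith [(abs_nonneg _).trans (hm z τ a)])
    by_cases hz : z = y ∧ τ ∈ l₁ ∧ a = v
    · rw [loopRate, loopRate, if_pos hz, if_pos ⟨hz.1, hpre.subset hz.2.1, hz.2.2⟩]
    · rw [loopRate, if_neg hz]
      exact (loopRate_mem_Icc hκ _ _ _ _ _).1
  · refine ⟨m.q, ?_, fun z τ a => ?_⟩
    · rw [(foldl_updateEntry_of_not h).1, loopRate, if_neg h, zero_mul, add_zero]
    · rw [sub_self, abs_zero]
      exact mul_nonneg (loopRate_mem_Icc hκ _ _ _ _ _).1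
        (by linarith [(abs_nonneg _).trans (hm z τ a)])

end Loop

/-! ### The table along one sample path -/

section Path

variable {X U Δ : Type*} {R : PRM Δ} {L : X → Set Δ} {disc : ℝ} {κ : X → R.Ω → U → ℕ → ℝ}
  {q₀ : X → R.Ω → U → ℝ} {x : ℕ → X} {u : ℕ → U} {x' : ℕ → X} {E : ℕ → List R.Ω}

/-- The learning rate at which training step `t` moves the entry `(y, σ, v)`. -/
def learnRate (R : PRM Δ) (L : X → Set Δ) (disc : ℝ) (κ : X → R.Ω → U → ℕ → ℝ)
    (q₀ : X → R.Ω → U → ℝ) (x : ℕ → X) (u : ℕ → U) (x' : ℕ → X) (E : ℕ → List R.Ω)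
    (t : ℕ) (y : X) (σ : R.Ω) (v : U) : ℝ :=
  loopRate κ (x t) (u t) (E t) (learn R L disc κ q₀ x u x' E t) y σ v

lemma abs_learn_le {B : ℝ} (hκ : ∀ x ϱ u n, κ x ϱ u n ∈ Set.Icc (0 : ℝ) 1)
    (hB : ∀ q : X → R.Ω → U → ℝ, (∀ y σ v, |q y σ v| ≤ B) → ∀ y σ, |qTarget R L disc q y σ| ≤ B)
    (hq₀ : ∀ y σ v, |q₀ y σ v| ≤ B) (t : ℕ) (y : X) (σ : R.Ω) (v : U) :
    |(learn R L disc κ q₀ x u x' E t).q y σ v| ≤ B := by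
  induction t generalizing y σ v with
  | zero => exact hq₀ y σ v
  | succ t ih => exact abs_foldl_updateEntry_le hκ hB _ ih y σ v

/-- The rates that an entry has received up to time `n` are the first terms of its rate
sequence, with idle steps in between. -/
lemma sum_learnRate (hE : ∀ t, (E t).Nodup) {f : ℝ → ℝ} (hf : f 0 = 0) (n : ℕ) (y : X) (σ : R.Ω)
    (v : U) : ∑ t ∈ Finset.range n, f (learnRate R L disc κ q₀ x u x' E t y σ v) =
      ∑ k ∈ Finset.range ((learn R L disc κ q₀ x u x' E n).count y σ v), f (κ y σ v k) := by
  induction n with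
  | zero => simp [learn]
  | succ n ih =>
    rw [Finset.sum_range_succ, ih, learnRate, loopRate, learn]
    split_ifs with h
    · obtain ⟨rfl, hσ, rfl⟩ := h
      rw [(foldl_updateEntry_of_mem (hE n) _ hσ).1, Finset.sum_range_succ]
    · rw [(foldl_updateEntry_of_not h).2, hf, add_zero]

lemma tendsto_learn_count (hE : ∀ t, (E t).Nodup) {y : X} {σ : R.Ω} {v : U}
    (h : ∃ᶠ t in atTop, x t = y ∧ σ ∈ E t ∧ u t = v) :
    Tendsto (fun t => (learn R L disc κ q₀ x u x' E t).count y σ v) atTop atTop := by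
  have hmono : Monotone fun t => (learn R L disc κ q₀ x u x' E t).count y σ v := by
    refine monotone_nat_of_le_succ fun t => ?_
    by_cases h : y = x t ∧ σ ∈ E t ∧ v = u t
    · obtain ⟨rfl, hσ, rfl⟩ := h
      simp only [learn]
      rw [(foldl_updateEntry_of_mem (hE t) _ hσ).1]
      exact Nat.le_succ _
    · simp only [learn]
      rw [(foldl_updateEntry_of_not h).2]
  refine tendsto_atTop_atTop_of_monotone hmono fun k => ?_
  induction k with
  | zero => exact ⟨0, Nat.zero_le _⟩
  | succ k ih =>
    obtain ⟨n, hn⟩ := ih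
    obtain ⟨t, ht, rfl, hσ, rfl⟩ := frequently_atTop.1 h n
    refine ⟨t + 1, ?_⟩
    rw [learn, (foldl_updateEntry_of_mem (hE t) _ hσ).1]
    exact Nat.succ_le_succ (hn.trans (hmono ht))

lemma tendsto_sum_learnRate (hE : ∀ t, (E t).Nodup)
    (hκ : ∀ x ϱ u n, κ x ϱ u n ∈ Set.Icc (0 : ℝ) 1) {y : X} {σ : R.Ω} {v : U}
    (hsum : ¬ Summable (κ y σ v)) (h : ∃ᶠ t in atTop, x t = y ∧ σ ∈ E t ∧ u t = v) :
    Tendsto (fun n => ∑ t ∈ Finset.range n, learnRate R L disc κ q₀ x u x' E t y σ v)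
      atTop atTop := by
  have h1 := fun n => sum_learnRate (L := L) (disc := disc) (κ := κ) (q₀ := q₀) (x := x) (u := u)
    (x' := x') (f := id) hE rfl n y σ v
  simp only [id] at h1
  simp only [h1]
  exact ((not_summable_iff_tendsto_nat_atTop_of_nonneg fun k => (hκ y σ v k).1).1 hsum).comp
    (tendsto_learn_count hE h)

lemma sum_learnRate_sq_le (hE : ∀ t, (E t).Nodup) {y : X} {σ : R.Ω} {v : U}
    (hsq : Summable fun k => κ y σ v k ^ 2) (n : ℕ) :
    ∑ t ∈ Finset.range n, learnRate R L disc κ q₀ x u x' E t y σ v ^ 2 ≤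
      ∑' k, κ y σ v k ^ 2 := by
  rw [sum_learnRate (f := fun r => r ^ 2) hE (by simp)]
  exact hsq.sum_le_tsum _ fun k _ => sq_nonneg _

lemma summable_learnRate_sq (hE : ∀ t, (E t).Nodup) {y : X} {σ : R.Ω} {v : U}
    (hsq : Summable fun k => κ y σ v k ^ 2) :
    Summable fun t => learnRate R L disc κ q₀ x u x' E t y σ v ^ 2 :=
  summable_of_sum_range_le (fun _ => sq_nonneg _) fun n => sum_learnRate_sq_le hE hsq n

end Path

section Measurability

variable {X U Δ W : Type*} [Finite X] [Finite U] {mW : MeasurableSpace W} {μ : Measure W}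
  {ℱ : Filtration ℕ mW} {M : MDP X U} {R : PRM Δ} [Finite R.Ω] {L : X → Set Δ}
  {x : ℕ → W → X} {ϱ : ℕ → W → R.Ω} {u : ℕ → W → U} {x' : ℕ → W → X} {E : ℕ → W → List R.Ω}

/-- The memory takes countably many values, so it is measurable even for the discrete
`σ`-algebra. -/
lemma IsTrainingRun.measurable_learn (hrun : IsTrainingRun μ ℱ M R L x ϱ u x' E)
    (disc : ℝ) (κ : X → R.Ω → U → ℕ → ℝ) (q₀ : X → R.Ω → U → ℝ) (t : ℕ) :
    Measurable[ℱ t, ⊤] fun w => learn R L disc κ q₀ (fun s => x s w) (fun s => u s w)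
      (fun s => x' s w) (fun s => E s w) t := by
  induction t with
  | zero => exact @measurable_const _ _ ⊤ (ℱ 0) _
  | succ t ih =>
    have hle : ℱ t ≤ ℱ (t + 1) := ℱ.mono t.le_succ
    have h1 := measurable_top_map₂ ((hrun.measurable_x t).mono hle le_rfl)
      ((hrun.measurable_u t).mono hle le_rfl) Prod.mk
    have h2 := measurable_top_map₂ (hrun.measurable_x' t) ((hrun.measurable_E t).mono hle le_rfl)
      Prod.mk
    have h3 := measurable_top_map₂ h1 h2 Prod.mk
    exact measurable_top_map₂ h3 (ih.mono hle le_rfl) fun z m =>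
      z.2.2.foldl (updateEntry R L disc κ z.1.1 z.1.2 z.2.1) m

/-- Every quantity computed from the state, the action, the pool and the memory of step `t` is
known before the successor state is drawn. -/
lemma IsTrainingRun.stronglyMeasurable_of_memory (hrun : IsTrainingRun μ ℱ M R L x ϱ u x' E)
    (disc : ℝ) (κ : X → R.Ω → U → ℕ → ℝ) (q₀ : X → R.Ω → U → ℝ) (t : ℕ)
    (f : X → U → List R.Ω → Memory X U R → ℝ) :
    StronglyMeasurable[ℱ t] fun w => f (x t w) (u t w) (E t w)
      (learn R L disc κ q₀ (fun s => x s w) (fun s => u s w)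
        (fun s => x' s w) (fun s => E s w) t) := by
  have h1 := measurable_top_map₂ (hrun.measurable_x t) (hrun.measurable_u t) Prod.mk
  have h2 := measurable_top_map₂ h1 (hrun.measurable_E t) Prod.mk
  have h3 := measurable_top_map₂ h2 (hrun.measurable_learn disc κ q₀ t) fun z m =>
    f z.1.1 z.1.2 z.2 m
  exact (h3.mono le_rfl le_top).stronglyMeasurable

end Measurability

/-! ### Convergence of the table -/

section Convergence

variable {X U Δ : Type*} [Finite X]

/-- The payoff that training step `t` contributes to the entry `(y, σ, v)` if the observed
successor state is `a`: the learning rate times the target. -/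
def stepPayoff (R : PRM Δ) (L : X → Set Δ) (disc : ℝ) (κ : X → R.Ω → U → ℕ → ℝ)
    (q₀ : X → R.Ω → U → ℝ) (x : ℕ → X) (u : ℕ → U) (x' : ℕ → X) (E : ℕ → List R.Ω)
    (t : ℕ) (y : X) (σ : R.Ω) (v : U) (a : X) : ℝ :=
  learnRate R L disc κ q₀ x u x' E t y σ v *
    qTarget R L disc (learn R L disc κ q₀ x u x' E t).q a σ

/-- The deviation of the contributed payoff from its expectation given the past. -/
def stepNoise (M : MDP X U) (R : PRM Δ) (L : X → Set Δ) (κ : X → R.Ω → U → ℕ → ℝ)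
    (q₀ : X → R.Ω → U → ℝ) (x : ℕ → X) (u : ℕ → U) (x' : ℕ → X) (E : ℕ → List R.Ω)
    (t : ℕ) (y : X) (σ : R.Ω) (v : U) : ℝ :=
  stepPayoff R L M.disc κ q₀ x u x' E t y σ v (x' t) -
    (M.prob (x t) (u t)).mean (stepPayoff R L M.disc κ q₀ x u x' E t y σ v)

lemma stepNoise_eq (M : MDP X U) (R : PRM Δ) (L : X → Set Δ) (κ : X → R.Ω → U → ℕ → ℝ)
    (q₀ : X → R.Ω → U → ℝ) (x : ℕ → X) (u : ℕ → U) (x' : ℕ → X) (E : ℕ → List R.Ω)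
    (t : ℕ) (y : X) (σ : R.Ω) (v : U) :
    stepNoise M R L κ q₀ x u x' E t y σ v = learnRate R L M.disc κ q₀ x u x' E t y σ v *
      (qTarget R L M.disc (learn R L M.disc κ q₀ x u x' E t).q (x' t) σ -
        (M.prob y v).mean fun a =>
          qTarget R L M.disc (learn R L M.disc κ q₀ x u x' E t).q a σ) := by
  by_cases h : y = x t ∧ σ ∈ E t ∧ v = u t
  · rw [stepNoise, h.1, h.2.2, mul_sub, ← PMF.mean_const_mul]
    rfl
  · have h0 : learnRate R L M.disc κ q₀ x u x' E t y σ v = 0 := by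
      rw [learnRate, loopRate, if_neg h]
    have h1 : stepPayoff R L M.disc κ q₀ x u x' E t y σ v = fun _ => 0 := by
      ext a
      rw [stepPayoff, h0, zero_mul]
    rw [stepNoise, h1, PMF.mean_const, h0, zero_mul, sub_zero]

variable [Finite U] [Nonempty U]

/-- Bounded rewards and `λ < 1` confine the targets of a bounded table to one fixed interval,
which can be taken as large as one likes. -/
lemma exists_bound_qTarget (R : PRM Δ) [Finite R.Ω] (L : X → Set Δ) {disc : ℝ} (h0 : 0 ≤ disc)
    (h1 : disc < 1) (K : ℝ) :
    ∃ B, K ≤ B ∧ ∀ q : X → R.Ω → U → ℝ, (∀ y σ v, |q y σ v| ≤ B) →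
      ∀ y σ, |qTarget R L disc q y σ| ≤ B := by
  obtain ⟨C, hC⟩ := (Set.finite_range fun z : R.Ω × X => |R.δr z.1 (L z.2)|).bddAbove
  set B := max (max K 0) (C / (1 - disc)) with hBdef
  have hCB : C + disc * B ≤ B := by
    have : C / (1 - disc) ≤ B := le_max_right _ _
    rw [div_le_iff₀ (by linarith)] at this
    linarith
  exact ⟨B, (le_max_left _ _).trans (le_max_left _ _), fun q hq y σ =>
    (abs_qTarget_le R L h0 hq ((le_max_right _ _).trans (le_max_left _ _)) (hC ⟨(σ, y), rfl⟩)).trans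
      hCB⟩

/-- Convergence on a single sample path on which every relevant triple is visited infinitely often
and the accumulated sampling noise converges. -/
lemma tendsto_learn_of_noise (M : MDP X U) (hdisc : M.disc < 1) (R : PRM Δ) [Finite R.Ω]
    (L : X → Set Δ) {κ : X → R.Ω → U → ℕ → ℝ}
    (hκ_mem : ∀ x ϱ u n, κ x ϱ u n ∈ Set.Icc (0 : ℝ) 1)
    (hκ_sum : ∀ x ϱ u, ¬ Summable (κ x ϱ u))
    (hκ_sq : ∀ x ϱ u, Summable fun n => κ x ϱ u n ^ 2)
    {q₀ : X → R.Ω → U → ℝ} {x : ℕ → X} {u : ℕ → U} {x' : ℕ → X} {E : ℕ → List R.Ω}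
    (hE : ∀ t, (E t).Nodup)
    (hvisit : ∀ y σ v, σ ∉ R.terminal → ∃ᶠ t in atTop, x t = y ∧ σ ∈ E t ∧ u t = v)
    (hnoise : ∀ y σ v, ∃ l, Tendsto (fun n => ∑ t ∈ Finset.range n,
      stepNoise M R L κ q₀ x u x' E t y σ v) atTop (𝓝 l))
    (y : X) (σ : R.Ω) (v : U) (hσ : σ ∉ R.terminal) :
    Tendsto (fun t => (learn R L M.disc κ q₀ x u x' E t).q y σ v) atTop
      (𝓝 ((M.product R L).optQ (y, σ) v)) := by
  cases nonempty_fintype X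
  cases nonempty_fintype U
  cases nonempty_fintype R.Ω
  set Q : X → R.Ω → U → ℝ := fun y σ v => (M.product R L).optQ (y, σ) v with hQ
  set q : ℕ → X → R.Ω → U → ℝ := fun t => (learn R L M.disc κ q₀ x u x' E t).q with hq
  set r : ℕ → X → R.Ω → U → ℝ := learnRate R L M.disc κ q₀ x u x' E with hr
  obtain ⟨K, hK⟩ := (Set.finite_range fun z : X × R.Ω × U =>
    max |q₀ z.1 z.2.1 z.2.2| |Q z.1 z.2.1 z.2.2|).bddAbove
  obtain ⟨B, hKB, hB⟩ := exists_bound_qTarget (X := X) (U := U) R L M.disc_pos.le hdisc K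
  have hK' (y σ v) : max |q₀ y σ v| |Q y σ v| ≤ B := (hK ⟨(y, σ, v), rfl⟩).trans hKB
  have hqB (t y σ v) : |q t y σ v| ≤ B :=
    abs_learn_le hκ_mem hB (fun y σ v => (le_max_left _ _).trans (hK' y σ v)) t y σ v
  have hB0 : 0 ≤ B := (abs_nonneg _).trans (hqB 0 y σ v)
  have hr01 (t y σ v) : r t y σ v ∈ Set.Icc (0 : ℝ) 1 := loopRate_mem_Icc hκ_mem _ _ _ _ _
  have hrsq (y σ v) : Summable fun t => r t y σ v ^ 2 := summable_learnRate_sq hE (hκ_sq y σ v)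
  let ι := X × {σ : R.Ω // σ ∉ R.terminal} × U
  let D : ℕ → ι → ℝ := fun t i => q t i.1 i.2.1 i.2.2 - Q i.1 i.2.1 i.2.2
  let F : ℕ → ι → ℝ := fun t i =>
    ((M.prob i.1 i.2.2).mean fun a => qTarget R L M.disc (q t) a i.2.1) - Q i.1 i.2.1 i.2.2
  let α : ℕ → ι → ℝ := fun t i => r t i.1 i.2.1 i.2.2
  let n : ℕ → ι → ℝ := fun t i => D (t + 1) i - ((1 - α t i) * D t i + α t i * F t i)
  have hF (t c) (hD : ∀ j, |D t j| ≤ c) (i) : |F t i| ≤ M.disc * c := by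
    have hc : 0 ≤ c := (abs_nonneg _).trans (hD i)
    simp only [F, hQ]
    rw [M.optQ_product_eq_mean_qTarget hdisc R L i.2.1.2, ← PMF.mean_sub]
    exact PMF.abs_mean_le _ fun a => abs_qTarget_sub_le R L M.disc_pos.le hc
      (fun y σ v hσ => hD (y, ⟨σ, hσ⟩, v)) a _
  have hn (i) : ∃ l, Tendsto (fun N => ∑ t ∈ Finset.range N, n t i) atTop (𝓝 l) := by
    obtain ⟨y, ⟨σ, hσ⟩, v⟩ := i
    obtain ⟨l, hl⟩ := hnoise y σ v
    set b : ℕ → ℝ := fun t =>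
      n t (y, ⟨σ, hσ⟩, v) - stepNoise M R L κ q₀ x u x' E t y σ v with hb
    -- The error made by updating the pool one after another is of second order in the rates.
    have hbound (t) : ‖b t‖ ≤
        (2 * B) * ∑ j : X × R.Ω × U, (r t y σ v ^ 2 + r t j.1 j.2.1 j.2.2 ^ 2) := by
      obtain ⟨q', h1, h2⟩ := exists_foldl_updateEntry_eq (x := x t) (x' := x' t) (u := u t) hκ_mem hB
        (hE t) (hqB t) y σ v
      set c := ∑ j : X × R.Ω × U, r t j.1 j.2.1 j.2.2 * (2 * B) with hc
      have hcj (z τ a) : |q' z τ a - q t z τ a| ≤ c := (h2 z τ a).trans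
        (Finset.single_le_sum (f := fun j : X × R.Ω × U => r t j.1 j.2.1 j.2.2 * (2 * B))
          (fun j _ => mul_nonneg (hr01 _ _ _ _).1 (by linarith)) (Finset.mem_univ (z, τ, a)))
      have hc0 : 0 ≤ c := (abs_nonneg _).trans (hcj y σ v)
      have h3 : b t = r t y σ v *
          (qTarget R L M.disc q' (x' t) σ - qTarget R L M.disc (q t) (x' t) σ) := by
        have h4 : q (t + 1) y σ v = q t y σ v +
            r t y σ v * (qTarget R L M.disc q' (x' t) σ - q t y σ v) := h1
        simp only [hb, n, D, F, α, stepNoise_eq, h4, ← hr]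
        ring
      rw [h3, Real.norm_eq_abs, abs_mul, abs_of_nonneg (hr01 t y σ v).1]
      have h5 := abs_qTarget_sub_le R L M.disc_pos.le hc0 (fun z τ a _ => hcj z τ a) (x' t) σ
      calc _ ≤ r t y σ v * c := mul_le_mul_of_nonneg_left
              (h5.trans (mul_le_of_le_one_left hc0 hdisc.le)) (hr01 t y σ v).1
        _ = (2 * B) * ∑ j : X × R.Ω × U, r t y σ v * r t j.1 j.2.1 j.2.2 := by
            rw [hc, Finset.mul_sum, Finset.mul_sum]
            exact Finset.sum_congr rfl fun j _ => by ring
        _ ≤ _ := by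
            refine mul_le_mul_of_nonneg_left (Finset.sum_le_sum fun j _ => ?_) (by linarith)
            nlinarith [sq_nonneg (r t y σ v - r t j.1 j.2.1 j.2.2), sq_nonneg (r t y σ v),
              sq_nonneg (r t j.1 j.2.1 j.2.2)]
    have hsq : Summable fun t => ∑ j : X × R.Ω × U, (r t y σ v ^ 2 + r t j.1 j.2.1 j.2.2 ^ 2) :=
      summable_sum fun (j : X × R.Ω × U) _ => (hrsq y σ v).add (hrsq j.1 j.2.1 j.2.2)
    have hsummable : Summable b := Summable.of_norm_bounded (hsq.mul_left (2 * B)) hbound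
    refine ⟨l + ∑' t, b t, ?_⟩
    convert hl.add hsummable.hasSum.tendsto_sum_nat using 2 with N
    rw [← Finset.sum_add_distrib]
    exact Finset.sum_congr rfl fun t _ => by simp [hb]
  have hα (i) : Tendsto (fun N => ∑ t ∈ Finset.range N, α t i) atTop atTop :=
    tendsto_sum_learnRate (y := i.1) (σ := i.2.1.1) (v := i.2.2) hE hκ_mem (hκ_sum _ _ _)
      (hvisit _ _ _ i.2.1.2)
  have hD (t i) : |D t i| ≤ 2 * B := (abs_sub _ _).trans (by
    linarith [hqB t i.1 i.2.1 i.2.2, (le_max_right _ _).trans (hK' i.1 i.2.1 i.2.2)])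
  have hrec (t i) : D (t + 1) i = (1 - α t i) * D t i + α t i * F t i + n t i :=
    (add_sub_cancel _ (D (t + 1) i)).symm
  have hlim := tendsto_zero_of_contracting_recursion (D := D) (F := F) (n := n) (α := α) (B := 2 * B)
    M.disc_pos.le hdisc (fun t i => hr01 t i.1 i.2.1 i.2.2)
    hα hrec hF hn hD
    (y, ⟨σ, hσ⟩, v)
  exact tendsto_sub_nhds_zero_iff.1 hlim

variable {W : Type*} {mW : MeasurableSpace W} {μ : Measure W} [IsProbabilityMeasure μ]
  {ℱ : Filtration ℕ mW} {M : MDP X U} {R : PRM Δ} [Finite R.Ω] {L : X → Set Δ}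
  {x : ℕ → W → X} {ϱ : ℕ → W → R.Ω} {u : ℕ → W → U} {x' : ℕ → W → X} {E : ℕ → W → List R.Ω}

/-- The noise is a martingale difference sequence bounded by a multiple of the learning rates, and
the squares of these have a deterministic bound on their sum. -/
lemma IsTrainingRun.ae_exists_tendsto_sum_stepNoise (hrun : IsTrainingRun μ ℱ M R L x ϱ u x' E)
    (hdisc : M.disc < 1) {κ : X → R.Ω → U → ℕ → ℝ}
    (hκ_mem : ∀ x ϱ u n, κ x ϱ u n ∈ Set.Icc (0 : ℝ) 1)
    (hκ_sq : ∀ x ϱ u, Summable fun n => κ x ϱ u n ^ 2)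
    (q₀ : X → R.Ω → U → ℝ) (y : X) (σ : R.Ω) (v : U) :
    ∀ᵐ w ∂μ, ∃ l, Tendsto (fun n => ∑ t ∈ Finset.range n,
      stepNoise M R L κ q₀ (fun s => x s w) (fun s => u s w) (fun s => x' s w) (fun s => E s w)
        t y σ v) atTop (𝓝 l) := by
  obtain ⟨K, hK⟩ := (Set.finite_range fun z : X × R.Ω × U => |q₀ z.1 z.2.1 z.2.2|).bddAbove
  obtain ⟨B, hKB, hB⟩ := exists_bound_qTarget (X := X) (U := U) R L M.disc_pos.le hdisc K
  have hqB (w t y σ v) : |(learn R L M.disc κ q₀ (fun s => x s w) (fun s => u s w)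
      (fun s => x' s w) (fun s => E s w) t).q y σ v| ≤ B :=
    abs_learn_le hκ_mem hB (fun y σ v => (hK ⟨(y, σ, v), rfl⟩).trans hKB) t y σ v
  set r : ℕ → W → ℝ := fun t w => learnRate R L M.disc κ q₀ (fun s => x s w) (fun s => u s w)
    (fun s => x' s w) (fun s => E s w) t y σ v with hr
  have hr01 (t w) : r t w ∈ Set.Icc (0 : ℝ) 1 := loopRate_mem_Icc hκ_mem _ _ _ _ _
  set g : ℕ → X → W → ℝ := fun t a w => stepPayoff R L M.disc κ q₀ (fun s => x s w)
    (fun s => u s w) (fun s => x' s w) (fun s => E s w) t y σ v a with hg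
  have hgm (t a) : StronglyMeasurable[ℱ t] (g t a) :=
    hrun.stronglyMeasurable_of_memory M.disc κ q₀ t fun x u l m =>
      loopRate κ x u l m y σ v * qTarget R L M.disc m.q a σ
  have hP (t a) : StronglyMeasurable[ℱ t] fun w => (M.prob (x t w) (u t w) a).toReal :=
    hrun.stronglyMeasurable_of_memory M.disc κ q₀ t fun x u _ _ => (M.prob x u a).toReal
  have hgle (t a w) : |g t a w| ≤ r t w * B := by
    simp only [hg, stepPayoff]
    rw [abs_mul, abs_of_nonneg (hr01 t w).1]
    exact mul_le_mul_of_nonneg_left (hB _ (hqB w t) a σ) (hr01 t w).1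
  have hB0 : 0 ≤ B := by
    obtain ⟨w⟩ := nonempty_of_isProbabilityMeasure μ
    exact (abs_nonneg _).trans (hqB w 0 y σ v)
  refine ae_exists_tendsto_sum_of_sq_sum_le (ℱ := ℱ) (C := (2 * B) ^ 2 * ∑' k, κ y σ v k ^ 2)
    (fun t => ?_) (fun t => ?_) fun n w => ?_
  · have hsample : Measurable[ℱ (t + 1), ⊤] fun w => g t (x' t w) w := by
      have hle : ℱ t ≤ ℱ (t + 1) := ℱ.mono t.le_succ
      have h1 := measurable_top_map₂ ((hrun.measurable_x t).mono hle le_rfl)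
        ((hrun.measurable_u t).mono hle le_rfl) Prod.mk
      have h2 := measurable_top_map₂ (hrun.measurable_x' t)
        ((hrun.measurable_E t).mono hle le_rfl) Prod.mk
      have h3 := measurable_top_map₂ h1 h2 Prod.mk
      exact measurable_top_map₂ h3
        ((hrun.measurable_learn M.disc κ q₀ t).mono hle le_rfl) fun z m =>
          loopRate κ z.1.1 z.1.2 z.2.2 m y σ v * qTarget R L M.disc m.q z.2.1 σ
    refine (hsample.mono le_rfl le_top).stronglyMeasurable.sub ?_
    exact (hrun.stronglyMeasurable_of_memory M.disc κ q₀ t fun x u l m => (M.prob x u).mean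
      fun a => loopRate κ x u l m y σ v * qTarget R L M.disc m.q a σ).mono (ℱ.mono t.le_succ)
  · exact condExp_sample_sub_mean (ℱ.le t) ((hrun.measurable_x' t).mono (ℱ.le _) le_rfl) (hP t)
      (hrun.transition t) (hgm t) (C := B) fun a w =>
        (hgle t a w).trans (mul_le_of_le_one_left hB0 (hr01 t w).2)
  · have hle (t) : stepNoise M R L κ q₀ (fun s => x s w) (fun s => u s w) (fun s => x' s w)
        (fun s => E s w) t y σ v ^ 2 ≤ (2 * B) ^ 2 * r t w ^ 2 := by
      rw [← mul_pow]
      refine sq_le_sq' ?_ ?_ <;>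
      · have h1 := abs_le.1 (hgle t (x' t w) w)
        have h2 := abs_le.1 ((M.prob (x t w) (u t w)).abs_mean_le fun a => hgle t a w)
        simp only [hg] at h1 h2
        rw [stepNoise]
        linarith [h1.1, h1.2, h2.1, h2.2]
    refine (Finset.sum_le_sum fun t _ => hle t).trans ?_
    rw [← Finset.mul_sum]
    exact mul_le_mul_of_nonneg_left
      (sum_learnRate_sq_le (fun t => hrun.nodup t w) (hκ_sq y σ v) n) (sq_nonneg _)

end Convergence

end

/-! ### Convergence to the optimal policy -/

theorem mainTheorem1 {X U Δ W : Type*} [Finite X] [Finite U] [Nonempty U]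
    (M : MDP X U) (hdisc : M.disc < 1)
    (R : PRM Δ) [Finite R.Ω] (L : X → Set Δ)
    (κ : X → R.Ω → U → ℕ → ℝ)
    (hκ_mem : ∀ x ϱ u n, κ x ϱ u n ∈ Set.Icc (0 : ℝ) 1)
    (hκ_sum : ∀ x ϱ u, ¬ Summable (κ x ϱ u))
    (hκ_sq : ∀ x ϱ u, Summable fun n => κ x ϱ u n ^ 2)
    (q₀ : X → R.Ω → U → ℝ)
    [mW : MeasurableSpace W] (μ : Measure W) [IsProbabilityMeasure μ] (ℱ : Filtration ℕ mW)
    (x : ℕ → W → X) (ϱ : ℕ → W → R.Ω) (u : ℕ → W → U) (x' : ℕ → W → X)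
    (E : ℕ → W → List R.Ω)
    (hrun : IsTrainingRun μ ℱ M R L x ϱ u x' E)
    (hvisit : ∀ (y : X) (σ : R.Ω) (v : U), σ ∉ R.terminal →
      ∀ᵐ w ∂μ, ∃ᶠ t in atTop, x t w = y ∧ ϱ t w = σ ∧ u t w = v) :
    ∀ᵐ w ∂μ,
      (∀ (y : X) (σ : R.Ω) (v : U), σ ∉ R.terminal →
        Tendsto
          (fun t => (learn R L M.disc κ q₀ (fun s => x s w) (fun s => u s w) (fun s => x' s w)
            (fun s => E s w) t).q y σ v)
          atTop (𝓝 ((M.product R L).optQ (y, σ) v))) ∧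
      (∀ᶠ t in atTop, ∀ π : X × R.Ω → U,
        (∀ (y : X) (σ : R.Ω), σ ∉ R.terminal → ∀ v : U,
          (learn R L M.disc κ q₀ (fun s => x s w) (fun s => u s w) (fun s => x' s w)
            (fun s => E s w) t).q y σ v ≤
          (learn R L M.disc κ q₀ (fun s => x s w) (fun s => u s w) (fun s => x' s w)
            (fun s => E s w) t).q y σ (π (y, σ))) →
        (M.product R L).IsOptimal (Policy.ofMap π)) := by
  have hnoise : ∀ᵐ w ∂μ, ∀ y σ v, ∃ l, Tendsto (fun n => ∑ t ∈ Finset.range n,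
      stepNoise M R L κ q₀ (fun s => x s w) (fun s => u s w) (fun s => x' s w) (fun s => E s w)
        t y σ v) atTop (𝓝 l) :=
    ae_all_iff.2 fun y => ae_all_iff.2 fun σ => ae_all_iff.2 fun v =>
      hrun.ae_exists_tendsto_sum_stepNoise hdisc hκ_mem hκ_sq q₀ y σ v
  have hvisit' : ∀ᵐ w ∂μ, ∀ (y : X) (σ : R.Ω) (v : U), σ ∉ R.terminal →
      ∃ᶠ t in atTop, x t w = y ∧ ϱ t w = σ ∧ u t w = v :=
    ae_all_iff.2 fun y => ae_all_iff.2 fun σ => ae_all_iff.2 fun v =>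
      eventually_imp_distrib_left.2 (hvisit y σ v)
  filter_upwards [hnoise, hvisit'] with w hw hv
  have hconv := tendsto_learn_of_noise M hdisc R L hκ_mem hκ_sum hκ_sq (q₀ := q₀)
    (fun t => hrun.nodup t w)
    (fun y σ v hσ => (hv y σ v hσ).mono fun t ht => ⟨ht.1, ht.2.1 ▸ hrun.actual_mem t w, ht.2.2⟩) hw
  refine ⟨hconv, ?_⟩
  -- Eventually every strict comparison of optimal values is visible in the table.
  have hstrict : ∀ᶠ t in atTop, ∀ (y : X) (σ : R.Ω) (v v' : U), σ ∉ R.terminal →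
      (M.product R L).optQ (y, σ) v < (M.product R L).optQ (y, σ) v' →
      (learn R L M.disc κ q₀ (fun s => x s w) (fun s => u s w) (fun s => x' s w)
        (fun s => E s w) t).q y σ v <
      (learn R L M.disc κ q₀ (fun s => x s w) (fun s => u s w) (fun s => x' s w)
        (fun s => E s w) t).q y σ v' :=
    eventually_all.2 fun y => eventually_all.2 fun σ => eventually_all.2 fun v =>
      eventually_all.2 fun v' => eventually_imp_distrib_left.2 fun hσ =>
        eventually_imp_distrib_left.2 fun hlt =>
          (hconv y σ v hσ).eventually_lt (hconv y σ v' hσ) hlt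
  filter_upwards [hstrict] with t ht π hπ
  refine (M.product R L).isOptimal_ofMap_of_greedy hdisc ?_
  rintro ⟨y, σ⟩ v
  by_cases hσ : σ ∈ R.terminal
  · rw [M.optQ_product_terminal hdisc R L hσ, M.optQ_product_terminal hdisc R L hσ]
  · by_contra! hlt
    exact (ht y σ _ v hσ hlt).not_ge (hπ y σ hσ v)
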